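/- Let $L\ge 1$ and let $d_0,d_1,\dots,d_{2L}\in\mathbb N$ be layer widths with input dimension $n:=d_0$ and $d_{2L}=1$. Let $k\ge 2$ ($k=\infty$ allowed) and let $\mathcal X\subset\mathbb R^n$ be open. For $l=1,\dots,L$ and $i=1,\dots,d_{2l-1}$ let $[\sigma_l]_i\in C^k(\mathbb R,\mathbb R)$ be activation functions that are strictly monotone in the sense that $[\sigma_l]_i'>0$ on $\mathbb R$ or $[\sigma_l]_i'<0$ on $\mathbb R$, and let $\sigma_l:\mathbb R^{d_{2l-1}}\to\mathbb R^{d_{2l-1}}$ be the map that applies them component-wise. For weight matrices $W=(V_1,\dots,V_{2L})$, $V_j\in\mathbb R^{d_j\times d_{j-1}}$, and biases $\beta=(\beta_1,\dots,\beta_{2L})$, $\beta_j\in\mathbb R^{d_j}$, stacked into one parameter vector $v\in\mathbb R^{N}$, $N=\sum_{j=1}^{2L}(d_jd_{j-1}+d_j)$, let $\Phi_v:\mathcal X\to\mathbb R$ be the multilayer perceptron (MLP) $\Phi_v(x)=h_L$, where $$h_0=x,\qquad h_l=V_{2l}\,\sigma_l\bigl(V_{2l-1}h_{l-1}+\beta_{2l-1}\bigr)+\beta_{2l}\quad(l=1,\dots,L).$$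 Suppose that the MLP is augmented: the first layer $l^\ast\in\{0,\dots,2L\}$ of maximal width satisfies $d_{l^\ast}\ge n+1$, and $d_{j-1}\le d_j$ for $0<j\le l^\ast$, and $d_{j-1}\ge d_j$ for $l^\ast<j\le 2L$. Denote by $(\mathcal C1)^k(\mathcal X,\mathbb R)$ the set of $f\in C^k(\mathcal X,\mathbb R)$ with $\nabla f(x)\ne0$ for all $x\in\mathcal X$, and by $(\mathcal C2)^k(\mathcal X,\mathbb R)$ the set of $f\in C^k(\mathcal X,\mathbb R)$ that have at least one critical point in $\mathcal X$ and whose Hessian is non-singular at every critical point in $\mathcal X$. A function $f \in C^2(\mathcal X,\mathbb R)$ is a Morse function if its Hessian is non-singular at every critical point in $\mathcal X$. Then for all parameter vectors $v\in\mathbb R^N$ whose weight matrices all have full rank ($\operatorname{rank}V_j=\min\{d_j,d_{j-1}\}$ for all $j$), except possibly for a set of Lebesgue measure zero in $\mathbb R^N$, the function $\Phi_v$ is of class $(\mathcal C1)^k(\mathcal X,\mathbb R)$ or $(\mathcal C2)^k(\mathcal X,\mathbb R)$, and hence a Morse function. The same statement holds without the full-rank condition, that is, for Lebesgue-almost every $v\in\mathbb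 R^N$. -/

import Mathlib

noncomputable section

namespace MLP

/-! ### Critical points, Morse functions and the classes `(C1)^k`, `(C2)^k`

A function on an open set `X` of `ℝⁿ` is represented by a total function; everything below only
depends on its values on `X` when `X` is open. -/

/-- Hessian matrix of second partial derivatives `∂ᵢ ∂ⱼ f (p)`. -/
def hessian {n : ℕ} (f : EuclideanSpace ℝ (Fin n) → ℝ) (p : EuclideanSpace ℝ (Fin n)) :
    Matrix (Fin n) (Fin n) ℝ :=
  Matrix.of fun i j =>
    fderiv ℝ (fun y => fderiv ℝ f y (EuclideanSpace.single j 1)) p (EuclideanSpace.single i 1)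

/-- `f` is a Morse function on `X`: it is `C²` and all its critical points are non-degenerate. -/
def IsMorseOn {n : ℕ} (X : Set (EuclideanSpace ℝ (Fin n))) (f : EuclideanSpace ℝ (Fin n) → ℝ) :
    Prop :=
  ContDiffOn ℝ 2 f X ∧ ∀ p ∈ X, gradient f p = 0 → (hessian f p).det ≠ 0

/-- The class `(C1)^k(X, ℝ)`: `C^k` functions without critical points. -/
def classC1 {n : ℕ} (k : ℕ∞) (X : Set (EuclideanSpace ℝ (Fin n))) :
    Set (EuclideanSpace ℝ (Fin n) → ℝ) :=
  {f | ContDiffOn ℝ k f X ∧ ∀ p ∈ X, gradient f p ≠ 0}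

/-- The class `(C2)^k(X, ℝ)`: `C^k` functions with at least one critical point, all of whose
critical points are non-degenerate. -/
def classC2 {n : ℕ} (k : ℕ∞) (X : Set (EuclideanSpace ℝ (Fin n))) :
    Set (EuclideanSpace ℝ (Fin n) → ℝ) :=
  {f | ContDiffOn ℝ k f X ∧ (∃ p ∈ X, gradient f p = 0) ∧
    ∀ q ∈ X, gradient f q = 0 → (hessian f q).det ≠ 0}

/-! ### Multilayer perceptrons -/

/-- The widths of a scalar multilayer perceptron with `L = depth` main layers after the input.
`width j`, `0 ≤ j ≤ 2 L`, is the width `d_j` of the `j`-th layer in the joint enumeration: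
`d_{2l}` is the width of the main layer `h_l` and `d_{2l-1}` that of the pre-activation `a_l`.
The input dimension is `width 0`; values `width j` for `j > 2 L` are never used. -/
structure Architecture where
  depth : ℕ
  depth_pos : 1 ≤ depth
  width : ℕ → ℕ
  width_output : width (2 * depth) = 1

namespace Architecture

variable (A : Architecture)

/-- Augmented: the first layer of maximal width has at least `n + 1` nodes (`n` the input
dimension), the widths are non-decreasing up to this layer and non-increasing after it. -/
def IsAugmented : Prop :=
  ∃ m ≤ 2 * A.depth,
    (∀ j ≤ 2 * A.depth, A.width j ≤ A.width m) ∧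
    (∀ j < m, A.width j < A.width m) ∧
    A.width 0 + 1 ≤ A.width m ∧
    (∀ j < m, A.width j ≤ A.width (j + 1)) ∧
    (∀ j, m ≤ j → j < 2 * A.depth → A.width (j + 1) ≤ A.width j)

/-- Positions of the entries of the weight matrices `V_1, …, V_{2L}`
(the matrix `V_{j+1}`, of size `d_{j+1} × d_j`, has index `j`). -/
abbrev WeightIndex : Type :=
  Σ j : Fin (2 * A.depth), Fin (A.width (j + 1)) × Fin (A.width j)

/-- Positions of the entries of the bias vectors. -/
abbrev BiasIndex : Type :=
  Σ j : Fin (2 * A.depth), Fin (A.width (j + 1))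

/-- Parameter vectors: all weights and biases stacked into one vector of `ℝ^{N_W + N_B}`. -/
abbrev Params : Type := A.WeightIndex ⊕ A.BiasIndex → ℝ

variable {A}

/-- The weight matrix with index `j` in a parameter vector. -/
def weight (v : A.Params) (j : Fin (2 * A.depth)) :
    Matrix (Fin (A.width (j + 1))) (Fin (A.width j)) ℝ :=
  Matrix.of fun p q => v (Sum.inl ⟨j, (p, q)⟩)

/-- The bias vector with index `j` in a parameter vector. -/
def bias (v : A.Params) (j : Fin (2 * A.depth)) : Fin (A.width (j + 1)) → ℝ :=
  fun p => v (Sum.inr ⟨j, p⟩)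

/-- All weight matrices have full rank. -/
def FullRank (v : A.Params) : Prop :=
  ∀ j : Fin (2 * A.depth), (weight v j).rank = min (A.width (j + 1)) (A.width j)

variable (A) in
/-- Component-wise activation functions, one for every node of every pre-activation layer. -/
abbrev Activations : Type := ∀ l : Fin A.depth, Fin (A.width (2 * l + 1)) → ℝ → ℝ

/-- Every component is of class `C^k` and strictly monotone, in the sense that its derivative is
positive on all of `ℝ` or negative on all of `ℝ` (used for `1 ≤ k`). -/
def Admissible (k : ℕ∞) (σ : A.Activations) : Prop :=
  ∀ l i, ContDiff ℝ k (σ l i) ∧ ((∀ t, 0 < deriv (σ l i) t) ∨ (∀ t, deriv (σ l i) t < 0))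

/-- The main layers: `h_0 = x` and `h_{l+1} = W̃ (σ (W h_l + b)) + b̃`. -/
def mainLayer (σ : A.Activations) (v : A.Params) (x : Fin (A.width 0) → ℝ) :
    (l : ℕ) → l ≤ A.depth → Fin (A.width (2 * l)) → ℝ
  | 0, _ => x
  | l + 1, hl =>
    have h₁ : 2 * l < 2 * A.depth := by omega
    have h₂ : 2 * l + 1 < 2 * A.depth := by omega
    let a : Fin (A.width (2 * l + 1)) → ℝ :=
      (weight v ⟨2 * l, h₁⟩).mulVec (mainLayer σ v x l (Nat.le_of_succ_le hl)) +
        bias v ⟨2 * l, h₁⟩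
    (weight v ⟨2 * l + 1, h₂⟩).mulVec (fun i => σ ⟨l, hl⟩ i (a i)) + bias v ⟨2 * l + 1, h₂⟩

/-- The input-output map of the multilayer perceptron: the single component of the last layer. -/
def realize (σ : A.Activations) (v : A.Params) (x : EuclideanSpace ℝ (Fin (A.width 0))) : ℝ :=
  mainLayer σ v (fun i => x i) A.depth le_rfl
    ⟨0, by rw [A.width_output]; exact Nat.one_pos⟩

end Architecture

end MLP

end

open MeasureTheory Set Topology Matrix

/-! The Morse property says that `0` is a regular value of `x ↦ ∇Φ_v(x)`. Parametric transversality
gives this for almost every `v` once the `C¹` map `F(x, v) = ∇Φ_v(x)` has surjective derivative in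
`v` at its zeros (`ae_regular_zeros`).

Surjectivity comes from the shape of the network (`exists_direction_deriv_eq`). For almost every
`v`, the weights before the matrix entering the widest layer are injective and those after it are
surjective. Activations have invertible derivative, so the network is an immersion, then one affine
map, then a submersion. Perturbing that affine map while its value at `x` stays fixed adds any
prescribed linear form to the derivative of the output at `x`.

Transversality itself is reduced to equal dimensions. For `T : E → P` with `∂_v F ∘ T` invertible,
the zeros of `F(x, v + T w)` are locally a graph `w = g(x)`. Degenerate zeros give critical values
of `g`, which are null by Sard's theorem in the easy equidimensional `C¹` case. Fubini and a
countable dense set of `T` finish the argument. -/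

theorem ContinuousLinearMap.isInvertible_of_det_ne_zero {E : Type*} [NormedAddCommGroup E]
    [NormedSpace ℝ E] [FiniteDimensional ℝ E] {A : E →L[ℝ] E} (h : A.det ≠ 0) :
    A.IsInvertible :=
  ⟨A.toContinuousLinearEquivOfDetNeZero h, A.coe_toContinuousLinearEquivOfDetNeZero h⟩

/-! ### Parametric transversality -/

section Transversality

variable {E P : Type*} [NormedAddCommGroup E] [NormedSpace ℝ E] [FiniteDimensional ℝ E]
  [MeasurableSpace E] [BorelSpace E]
  [NormedAddCommGroup P] [NormedSpace ℝ P] [FiniteDimensional ℝ P]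
  [MeasurableSpace P] [BorelSpace P]

/-- Near a point where the partial derivative in the second variable is invertible, the zeros of a
`C¹` map with singular partial derivative in the first variable project to a null set. -/
theorem exists_nhds_snd_image_critical_null (μ : Measure E) [μ.IsAddHaarMeasure]
    {H : E × E → E} (hH : ContDiff ℝ 1 H) {u : E × E} (hu : H u = 0)
    (hdet : (fderiv ℝ H u ∘L .inr ℝ E E).det ≠ 0) :
    ∃ U ∈ 𝓝 u, μ (Prod.snd '' (U ∩ {p | H p = 0 ∧ (fderiv ℝ H p ∘L .inr ℝ E E).det ≠ 0 ∧
      (fderiv ℝ H p ∘L .inl ℝ E E).det = 0})) = 0 := by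
  have cdf : ContDiffAt ℝ 1 H u := hH.contDiffAt
  have inv := ContinuousLinearMap.isInvertible_of_det_ne_zero hdet
  set g := cdf.implicitFunction one_ne_zero inv with hg
  have h1 : ∀ᶠ x in 𝓝 u.1, H (x, g x) = 0 := by
    simpa [hu] using cdf.eventually_apply_implicitFunction one_ne_zero inv
  have h2 : ∀ᶠ p in 𝓝 u, H p = 0 ↔ g p.1 = p.2 := by
    simpa [hu] using cdf.eventually_apply_eq_iff_implicitFunction one_ne_zero inv
  have h3 : ∀ᶠ x in 𝓝 u.1, DifferentiableAt ℝ g x := by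
    have := (cdf.contDiffAt_implicitFunction one_ne_zero inv).eventually (by simp)
    filter_upwards [this] with x hx using hx.differentiableAt one_ne_zero
  -- The equation is kept on a whole neighbourhood of each nearby point, so that it can be
  -- differentiated there.
  have h4 := (continuous_fst.tendsto u).eventually (h1.eventually_nhds.and h3)
  refine ⟨_, h2.and h4, ?_⟩
  set S : Set E := {x | (∀ᶠ y in 𝓝 x, H (y, g y) = 0) ∧ DifferentiableAt ℝ g x ∧
    (fderiv ℝ H (x, g x) ∘L .inr ℝ E E).det ≠ 0 ∧ (fderiv ℝ H (x, g x) ∘L .inl ℝ E E).det = 0}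
  have hS : μ (g '' S) = 0 := by
    refine addHaar_image_eq_zero_of_det_fderivWithin_eq_zero μ (f' := fun x => fderiv ℝ g x)
      (fun x hx => hx.2.1.hasFDerivAt.hasFDerivWithinAt) ?_
    rintro x ⟨hx1, hx2, hx3, hx4⟩
    have hd : HasFDerivAt (fun y => H (y, g y))
        (fderiv ℝ H (x, g x) ∘L (ContinuousLinearMap.id ℝ E).prod (fderiv ℝ g x)) x :=
      (hH.differentiable one_ne_zero (x, g x)).hasFDerivAt.comp x
        ((hasFDerivAt_id x).prodMk hx2.hasFDerivAt)
    have h0 : HasFDerivAt (fun y => H (y, g y)) (0 : E →L[ℝ] E) x :=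
      (hasFDerivAt_const (0 : E) x).congr_of_eventuallyEq hx1
    have e := hd.unique h0
    -- Implicit differentiation: with `∂₂H` invertible, `∂₁H` is singular only if `Dg` is, so `x` is
    -- a critical point of `g`.
    have e2 : (fderiv ℝ H (x, g x) ∘L .inr ℝ E E) ∘L (-fderiv ℝ g x)
        = fderiv ℝ H (x, g x) ∘L .inl ℝ E E := by
      ext y
      have := congrArg (fun A : E →L[ℝ] E => A y) e
      have h5 : (y, fderiv ℝ g x y) = (y, 0) + ((0 : E), fderiv ℝ g x y) := by simp
      have h6 : ((0 : E), -fderiv ℝ g x y) = -((0 : E), fderiv ℝ g x y) := by simp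
      simp only [ContinuousLinearMap.comp_apply, ContinuousLinearMap.prod_apply,
        ContinuousLinearMap.id_apply, _root_.zero_apply,
        ContinuousLinearMap.inr_apply, ContinuousLinearMap.inl_apply,
        _root_.neg_apply] at this ⊢
      rw [h5, map_add] at this
      rw [h6, map_neg]
      exact (eq_neg_of_add_eq_zero_left this).symm
    have e3 : (fderiv ℝ H (x, g x) ∘L .inr ℝ E E).det * (-fderiv ℝ g x).det = 0 := by
      rw [← hx4, ← e2]
      exact (LinearMap.det_comp _ _).symm
    have e4 := (mul_eq_zero.1 e3).resolve_left hx3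
    by_contra hne
    obtain ⟨A, hA⟩ := ContinuousLinearMap.isInvertible_of_det_ne_zero hne
    have : (-fderiv ℝ g x).det ≠ 0 := by
      rw [← hA]
      exact (LinearEquiv.isUnit_det' (A.trans (ContinuousLinearEquiv.neg ℝ)).toLinearEquiv).ne_zero
    exact this e4
  refine measure_mono_null ?_ hS
  rintro _ ⟨⟨x, w⟩, ⟨⟨hp1, hp2, hp3⟩, hp4, hp5, hp6⟩, rfl⟩
  obtain rfl : g x = w := hp1.1 hp4
  exact ⟨x, ⟨hp2, hp3, hp5, hp6⟩, rfl⟩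

/-- By the Lindelöf property, countably many of the local neighbourhoods cover the critical set. -/
theorem snd_image_critical_null (μ : Measure E) [μ.IsAddHaarMeasure]
    {H : E × E → E} (hH : ContDiff ℝ 1 H) :
    μ (Prod.snd '' {p | H p = 0 ∧ (fderiv ℝ H p ∘L .inr ℝ E E).det ≠ 0 ∧
      (fderiv ℝ H p ∘L .inl ℝ E E).det = 0}) = 0 := by
  set S := {p | H p = 0 ∧ (fderiv ℝ H p ∘L .inr ℝ E E).det ≠ 0 ∧
      (fderiv ℝ H p ∘L .inl ℝ E E).det = 0} with hS
  have key : ∀ u : E × E, ∃ U ∈ 𝓝[S] u, u ∈ S → μ (Prod.snd '' (U ∩ S)) = 0 := fun u => by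
    by_cases hu : u ∈ S
    · obtain ⟨U, hU, h⟩ := exists_nhds_snd_image_critical_null μ hH hu.1 hu.2.1
      exact ⟨U, mem_nhdsWithin_of_mem_nhds hU, fun _ => h⟩
    · exact ⟨univ, Filter.univ_mem, fun h => absurd h hu⟩
  choose U hU hnull using key
  obtain ⟨t, hts, htc, hcov⟩ := TopologicalSpace.countable_cover_nhdsWithin (s := S)
    (f := U) fun u _ => hU u
  refine measure_mono_null (t := ⋃ u ∈ t, Prod.snd '' (U u ∩ S)) ?_
    ((measure_biUnion_null_iff htc).2 fun u hu => hnull u (hts hu))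
  rintro _ ⟨p, hp, rfl⟩
  obtain ⟨u, hu, hpu⟩ := mem_iUnion₂.1 (hcov hp)
  exact mem_iUnion₂.2 ⟨u, hu, p, ⟨hpu, hp⟩, rfl⟩

/-- Parametric transversality along a fixed family of parameter directions. -/
theorem ae_regular_zeros_of_direction (ν : Measure P) [ν.IsAddHaarMeasure]
    {F : E × P → E} (hF : ContDiff ℝ 1 F) (T : E →L[ℝ] P) :
    ∀ᵐ v ∂ν, ∀ x, F (x, v) = 0 → (fderiv ℝ F (x, v) ∘L .inr ℝ E P ∘L T).det ≠ 0 →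
      (fderiv ℝ F (x, v) ∘L .inl ℝ E P).det ≠ 0 := by
  have hcF : Continuous (fderiv ℝ F) := hF.continuous_fderiv one_ne_zero
  have hc1 : Continuous fun p => (fderiv ℝ F p ∘L .inr ℝ E P ∘L T).det :=
    ContinuousLinearMap.continuous_det.comp (by fun_prop)
  have hc2 : Continuous fun p => (fderiv ℝ F p ∘L .inl ℝ E P).det :=
    ContinuousLinearMap.continuous_det.comp (by fun_prop)
  -- The lower bound replaces `≠ 0` by a closed condition. Then `K N` is σ-compact, and so is its
  -- projection, which is therefore measurable, as Fubini requires.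
  let K : ℕ → Set (E × P) := fun N => {p | F p = 0 ∧
    1 / ((N : ℝ) + 1) ≤ |(fderiv ℝ F p ∘L .inr ℝ E P ∘L T).det| ∧
    (fderiv ℝ F p ∘L .inl ℝ E P).det = 0}
  have hK : ∀ N, IsClosed (K N) := fun N =>
    (isClosed_eq hF.continuous continuous_const).inter
      ((isClosed_le continuous_const hc1.abs).inter (isClosed_eq hc2 continuous_const))
  have hm : ∀ N, MeasurableSet (Prod.snd '' K N) := fun N => by
    obtain ⟨C, hC, hCe⟩ := (isSigmaCompact_univ.of_isClosed_subset (hK N) (subset_univ _)).image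
      (continuous_snd (X := E) (Y := P))
    rw [← hCe]
    exact MeasurableSet.iUnion fun n => (hC n).isClosed.measurableSet
  have main : ∀ N, ∀ᵐ v ∂ν, v ∈ (Prod.snd '' K N)ᶜ := fun N => by
    -- Fubini: it suffices that, for every `v`, almost every `w` makes `v + T w` good.
    refine ae_mem_of_ae_add_linearMap_mem (T : E →ₗ[ℝ] P) (Measure.addHaar) ν (hm N).compl
      fun v => ?_
    set H : E × E → E := fun p => F (p.1, v + T p.2)
    have hH : ContDiff ℝ 1 H := hF.comp (by fun_prop)
    have hd : ∀ p, fderiv ℝ H p = fderiv ℝ F (p.1, v + T p.2) ∘L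
        (ContinuousLinearMap.fst ℝ E E).prod (T ∘L ContinuousLinearMap.snd ℝ E E) := fun p => by
      refine HasFDerivAt.fderiv ?_
      refine (hF.differentiable one_ne_zero (p.1, v + T p.2)).hasFDerivAt.comp p ?_
      exact hasFDerivAt_fst.prodMk ((T.hasFDerivAt.comp p hasFDerivAt_snd).const_add v)
    have hnull := snd_image_critical_null (Measure.addHaar : Measure E) hH
    refine measure_mono_null ?_ hnull
    intro w hw
    simp only [mem_compl_iff, mem_ofPred_eq, not_not] at hw
    obtain ⟨⟨x, _⟩, ⟨h1, h2, h3⟩, rfl⟩ := hw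
    refine ⟨(x, w), ⟨h1, ?_, ?_⟩, rfl⟩
    · have : fderiv ℝ H (x, w) ∘L .inr ℝ E E =
          fderiv ℝ F (x, v + T w) ∘L .inr ℝ E P ∘L T := by
        rw [hd]; ext y; simp
      rw [this]
      exact abs_pos.1 (lt_of_lt_of_le (by positivity) h2)
    · have : fderiv ℝ H (x, w) ∘L .inl ℝ E E = fderiv ℝ F (x, v + T w) ∘L .inl ℝ E P := by
        rw [hd]; ext y; simp
      rw [this]
      exact h3
  filter_upwards [ae_all_iff.2 main] with v hv x h0 h1 h2
  obtain ⟨N, hN⟩ := exists_nat_one_div_lt (abs_pos.2 h1)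
  exact hv N ⟨(x, v), ⟨h0, hN.le, h2⟩, rfl⟩

/-- Parametric transversality: if `0` is a regular value in the parameter directions for almost
every parameter, then for almost every parameter all zeros are non-degenerate. -/
theorem ae_regular_zeros (ν : Measure P) [ν.IsAddHaarMeasure]
    {F : E × P → E} (hF : ContDiff ℝ 1 F)
    (hsurj : ∀ᵐ v ∂ν, ∀ x, F (x, v) = 0 →
      Function.Surjective (fderiv ℝ F (x, v) ∘L .inr ℝ E P)) :
    ∀ᵐ v ∂ν, ∀ x, F (x, v) = 0 → (fderiv ℝ F (x, v) ∘L .inl ℝ E P).det ≠ 0 := by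
  obtain ⟨D, hDc, hD⟩ := TopologicalSpace.exists_countable_dense (E →L[ℝ] P)
  have hall : ∀ᵐ v ∂ν, ∀ T ∈ D, ∀ x, F (x, v) = 0 →
      (fderiv ℝ F (x, v) ∘L .inr ℝ E P ∘L T).det ≠ 0 →
      (fderiv ℝ F (x, v) ∘L .inl ℝ E P).det ≠ 0 :=
    (ae_ball_iff hDc).2 fun T _ => ae_regular_zeros_of_direction ν hF T
  filter_upwards [hall, hsurj] with v hv hs x hx
  set A := fderiv ℝ F (x, v) ∘L .inr ℝ E P with hA
  obtain ⟨R, hR⟩ := (A : P →ₗ[ℝ] E).exists_rightInverse_of_surjective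
    (LinearMap.range_eq_top.2 (hs x hx))
  -- A right inverse of `A` is one good direction map. Goodness is an open condition, so the dense
  -- family `D` contains one too.
  have hopen : IsOpen {T : E →L[ℝ] P | (A ∘L T).det ≠ 0} :=
    isOpen_ne_fun (ContinuousLinearMap.continuous_det.comp (by fun_prop)) continuous_const
  have hne : {T : E →L[ℝ] P | (A ∘L T).det ≠ 0}.Nonempty := by
    refine ⟨LinearMap.toContinuousLinearMap R, ?_⟩
    simp [ContinuousLinearMap.det, hR]
  obtain ⟨T, hT, hTD⟩ := hD.inter_open_nonempty _ hopen hne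
  exact hv T hTD x hx hT

end Transversality

/-! ### Derivatives of feed-forward networks -/

section Network

/-- One layer: component-wise activation followed by an affine map. -/
def affineLayer {p q : ℕ} (s : Fin q → ℝ → ℝ) (W : Matrix (Fin p) (Fin q) ℝ) (b : Fin p → ℝ)
    (h : Fin q → ℝ) : Fin p → ℝ :=
  W *ᵥ (fun i => s i (h i)) + b

/-- The derivative is diagonal with nonzero entries. -/
theorem exists_hasFDerivAt_activation {q : ℕ} {s : Fin q → ℝ → ℝ}
    (hs : ∀ i, Differentiable ℝ (s i)) (hs' : ∀ i t, deriv (s i) t ≠ 0) (h : Fin q → ℝ) :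
    ∃ D : (Fin q → ℝ) →L[ℝ] (Fin q → ℝ),
      HasFDerivAt (fun h : Fin q → ℝ => fun i => s i (h i)) D h ∧ Function.Bijective D := by
  refine ⟨ContinuousLinearMap.pi fun i => deriv (s i) (h i) • ContinuousLinearMap.proj i,
    hasFDerivAt_pi.2 fun i => ?_, ?_, ?_⟩
  · exact (hs i (h i)).hasDerivAt.comp_hasFDerivAt h (hasFDerivAt_apply i h)
  · intro a b hab
    ext i
    have := congrFun hab i
    simpa [hs' i (h i)] using this
  · intro a
    refine ⟨fun i => (deriv (s i) (h i))⁻¹ * a i, ?_⟩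
    ext i
    simp [hs' i (h i)]

theorem exists_hasFDerivAt_affineLayer {p q : ℕ} {s : Fin q → ℝ → ℝ}
    (hs : ∀ i, Differentiable ℝ (s i)) (hs' : ∀ i t, deriv (s i) t ≠ 0)
    (W : Matrix (Fin p) (Fin q) ℝ) (b : Fin p → ℝ) (h : Fin q → ℝ) :
    ∃ D : (Fin q → ℝ) →L[ℝ] (Fin p → ℝ), HasFDerivAt (affineLayer s W b) D h ∧
      (Function.Injective W.mulVec → Function.Injective D) ∧
      (Function.Surjective W.mulVec → Function.Surjective D) := by
  obtain ⟨D, hD, hbij⟩ := exists_hasFDerivAt_activation hs hs' h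
  refine ⟨LinearMap.toContinuousLinearMap W.mulVecLin ∘L D, ?_, fun hW => ?_, fun hW => ?_⟩
  · exact ((LinearMap.toContinuousLinearMap W.mulVecLin).hasFDerivAt.comp h hD).add_const b
  · exact Function.Injective.comp (g := W.mulVec) hW hbij.1
  · exact Function.Surjective.comp (g := W.mulVec) hW hbij.2

variable {d : ℕ → ℕ} (s : ∀ j, Fin (d j) → ℝ → ℝ)

/-- The layers of a feed-forward network, in a uniform enumeration. -/
def feedForward (W : ∀ j, Matrix (Fin (d (j + 1))) (Fin (d j)) ℝ) (b : ∀ j, Fin (d (j + 1)) → ℝ)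
    (x : Fin (d 0) → ℝ) : ∀ j, Fin (d j) → ℝ
  | 0 => x
  | j + 1 => affineLayer (s j) (W j) (b j) (feedForward W b x j)

variable {s}

theorem feedForward_congr {W W' : ∀ j, Matrix (Fin (d (j + 1))) (Fin (d j)) ℝ}
    {b b' : ∀ j, Fin (d (j + 1)) → ℝ} (x : Fin (d 0) → ℝ) (j : ℕ)
    (hW : ∀ i < j, W' i = W i) (hb : ∀ i < j, b' i = b i) :
    feedForward s W' b' x j = feedForward s W b x j := by
  induction j with
  | zero => rfl
  | succ j ih =>
    simp only [feedForward]
    rw [hW j (Nat.lt_succ_self j), hb j (Nat.lt_succ_self j),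
      ih (fun i hi => hW i (by omega)) (fun i hi => hb i (by omega))]

theorem feedForward_injective_deriv (hs : ∀ j i, Differentiable ℝ (s j i))
    (hs' : ∀ j i t, deriv (s j i) t ≠ 0)
    (W : ∀ j, Matrix (Fin (d (j + 1))) (Fin (d j)) ℝ) (b : ∀ j, Fin (d (j + 1)) → ℝ)
    (x : Fin (d 0) → ℝ) (j : ℕ) (hW : ∀ i < j, Function.Injective (W i).mulVec) :
    ∃ D : (Fin (d 0) → ℝ) →L[ℝ] (Fin (d j) → ℝ),
      HasFDerivAt (fun y => feedForward s W b y j) D x ∧ Function.Injective D := by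
  induction j with
  | zero => exact ⟨_, hasFDerivAt_id x, Function.injective_id⟩
  | succ j ih =>
    obtain ⟨D, hD, hi⟩ := ih fun i hi => hW i (by omega)
    obtain ⟨D', hD', hi', -⟩ := exists_hasFDerivAt_affineLayer (hs j) (hs' j) (W j) (b j)
      (feedForward s W b x j)
    exact ⟨D' ∘L D, hD'.comp x hD, (hi' (hW j (Nat.lt_succ_self j))).comp hi⟩

/-- A single `G` serves all parameters that agree from layer `m` on, so it is unaffected by
perturbations of earlier layers. -/
theorem feedForward_factor (hs : ∀ j i, Differentiable ℝ (s j i))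
    (hs' : ∀ j i t, deriv (s j i) t ≠ 0)
    (W : ∀ j, Matrix (Fin (d (j + 1))) (Fin (d j)) ℝ) (b : ∀ j, Fin (d (j + 1)) → ℝ)
    {m j : ℕ} (hmj : m ≤ j) (hW : ∀ i, m ≤ i → i < j → Function.Surjective (W i).mulVec) :
    ∃ G : (Fin (d m) → ℝ) → Fin (d j) → ℝ,
      (∀ h, ∃ D : (Fin (d m) → ℝ) →L[ℝ] (Fin (d j) → ℝ),
        HasFDerivAt G D h ∧ Function.Surjective D) ∧
      ∀ W' b', (∀ i, m ≤ i → W' i = W i) → (∀ i, m ≤ i → b' i = b i) →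
        ∀ x, feedForward s W' b' x j = G (feedForward s W' b' x m) := by
  induction j, hmj using Nat.le_induction with
  | base => exact ⟨id, fun h => ⟨_, hasFDerivAt_id h, Function.surjective_id⟩, fun _ _ _ _ _ => rfl⟩
  | succ j hmj ih =>
    obtain ⟨G, hG, hfac⟩ := ih fun i h1 h2 => hW i h1 (by omega)
    refine ⟨affineLayer (s j) (W j) (b j) ∘ G, fun h => ?_, fun W' b' h1 h2 x => ?_⟩
    · obtain ⟨D, hD, hi⟩ := hG h
      obtain ⟨D', hD', -, hi'⟩ := exists_hasFDerivAt_affineLayer (hs j) (hs' j) (W j) (b j) (G h)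
      exact ⟨D' ∘L D, hD'.comp h hD, (hi' (hW j hmj (Nat.lt_succ_self j))).comp hi⟩
    · simp only [feedForward, Function.comp]
      rw [hfac W' b' h1 h2 x, h1 j hmj, h2 j hmj]

/-- Perturbing the weights and biases between layers `m` and `m + 1` in such a way that the value
of layer `m + 1` at `x` is fixed changes the derivative of a given output component at `x` by an
arbitrary linear form, and does so linearly along the perturbation. -/
theorem exists_direction_deriv_eq (hs : ∀ j i, Differentiable ℝ (s j i))
    (hs' : ∀ j i t, deriv (s j i) t ≠ 0)
    (W : ∀ j, Matrix (Fin (d (j + 1))) (Fin (d j)) ℝ) (b : ∀ j, Fin (d (j + 1)) → ℝ)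
    {m J : ℕ} (hmJ : m < J) (hinj : ∀ i < m, Function.Injective (W i).mulVec)
    (hsurj : ∀ i, m < i → i < J → Function.Surjective (W i).mulVec)
    (x : Fin (d 0) → ℝ) (o : Fin (d J)) (ξ : (Fin (d 0) → ℝ) →L[ℝ] ℝ) :
    ∃ (δ : ∀ j, Matrix (Fin (d (j + 1))) (Fin (d j)) ℝ) (ε : ∀ j, Fin (d (j + 1)) → ℝ)
      (D₀ : (Fin (d 0) → ℝ) →L[ℝ] ℝ),
      (∀ j, j ≠ m → δ j = 0) ∧ (∀ j, j ≠ m → ε j = 0) ∧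
      ∀ t : ℝ, HasFDerivAt (fun y => feedForward s (W + t • δ) (b + t • ε) y J o)
        (D₀ + t • ξ) x := by
  obtain ⟨D, hD, hDi⟩ := feedForward_injective_deriv hs hs' W b x m hinj
  obtain ⟨A, hA, hAb⟩ := exists_hasFDerivAt_activation (hs m) (hs' m) (feedForward s W b x m)
  obtain ⟨G, hG, hfac⟩ := feedForward_factor hs hs' W b (Nat.succ_le_of_lt hmJ)
    fun i h1 h2 => hsurj i (by omega) h2
  set z : (Fin (d 0) → ℝ) → Fin (d m) → ℝ := fun y i => s m i (feedForward s W b y m i) with hz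
  have hz' : HasFDerivAt z (A ∘L D) x :=
    HasFDerivAt.comp (f := fun y => feedForward s W b y m) x hA hD
  obtain ⟨B, hB, hBs⟩ := hG (W m *ᵥ z x + b m)
  -- `e` is a direction in layer `m + 1` along which output `o` moves at unit speed.
  obtain ⟨e, he⟩ := hBs (Pi.single o 1)
  have hBe : B e o = 1 := by simp [he]
  -- Injectivity lets `ξ` factor through the activated layer `m`, as `η ∘ A ∘ D`. The rank-one
  -- matrix `M` then sends this form into the direction `e`.
  obtain ⟨R, hR⟩ := ((A ∘L D : (Fin (d 0) → ℝ) →L[ℝ] (Fin (d m) → ℝ)) :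
    (Fin (d 0) → ℝ) →ₗ[ℝ] (Fin (d m) → ℝ)).exists_leftInverse_of_injective
    (LinearMap.ker_eq_bot.2 (hAb.1.comp hDi))
  let η : (Fin (d m) → ℝ) →ₗ[ℝ] ℝ := (ξ : (Fin (d 0) → ℝ) →ₗ[ℝ] ℝ) ∘ₗ R
  have hη : ∀ y, η (A (D y)) = ξ y := fun y =>
    congrArg ξ (congrArg (fun L : (Fin (d 0) → ℝ) →ₗ[ℝ] (Fin (d 0) → ℝ) => L y) hR)
  let M : Matrix (Fin (d (m + 1))) (Fin (d m)) ℝ := LinearMap.toMatrix' (η.smulRight e)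
  have hM : ∀ w, M *ᵥ w = η w • e := fun w => by
    simp [M, LinearMap.toMatrix'_mulVec]
  obtain ⟨δ, hδ, hδ'⟩ : ∃ δ : ∀ j, Matrix (Fin (d (j + 1))) (Fin (d j)) ℝ,
      δ m = M ∧ ∀ j, j ≠ m → δ j = 0 :=
    ⟨Pi.single m M, Pi.single_eq_same _ _, fun j hj => Pi.single_eq_of_ne hj _⟩
  -- The bias cancels the effect of `M` at `x`. So `G` is differentiated at a point independent of
  -- `t`, and the total derivative is affine in `t`.
  obtain ⟨ε, hε, hε'⟩ : ∃ ε : ∀ j, Fin (d (j + 1)) → ℝ,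
      ε m = -(M *ᵥ z x) ∧ ∀ j, j ≠ m → ε j = 0 :=
    ⟨Pi.single (M := fun j => Fin (d (j + 1)) → ℝ) m (-(M *ᵥ z x)), Pi.single_eq_same _ _,
      fun j hj => Pi.single_eq_of_ne hj _⟩
  refine ⟨δ, ε, (ContinuousLinearMap.proj o ∘L B) ∘L
    (LinearMap.toContinuousLinearMap (W m).mulVecLin ∘L (A ∘L D)), hδ', hε', fun t => ?_⟩
  have hWt : ∀ i, i ≠ m → (W + t • δ) i = W i := fun i hi => by simp [hδ' i hi]
  have hbt : ∀ i, i ≠ m → (b + t • ε) i = b i := fun i hi => by simp [hε' i hi]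
  have hlayer : ∀ y, feedForward s (W + t • δ) (b + t • ε) y (m + 1) =
      W m *ᵥ z y + b m + t • (M *ᵥ z y - M *ᵥ z x) := fun y => by
    simp only [feedForward, affineLayer]
    rw [feedForward_congr (W := W) (b := b) y m (fun i hi => hWt i hi.ne)
      (fun i hi => hbt i hi.ne)]
    simp only [Pi.add_apply, Pi.smul_apply, hδ, hε, Matrix.add_mulVec, Matrix.smul_mulVec,
      smul_neg, smul_sub]
    abel
  have hfun : (fun y => feedForward s (W + t • δ) (b + t • ε) y J o) =
      fun y => G (W m *ᵥ z y + b m + t • (M *ᵥ z y - M *ᵥ z x)) o := by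
    funext y
    rw [hfac _ _ (fun i hi => hWt i (by omega)) (fun i hi => hbt i (by omega)), hlayer]
  rw [hfun]
  have h1 : HasFDerivAt (fun y => W m *ᵥ z y)
      (LinearMap.toContinuousLinearMap (W m).mulVecLin ∘L (A ∘L D)) x :=
    (LinearMap.toContinuousLinearMap (W m).mulVecLin).hasFDerivAt.comp x hz'
  have h2 : HasFDerivAt (fun y => M *ᵥ z y)
      (LinearMap.toContinuousLinearMap M.mulVecLin ∘L (A ∘L D)) x :=
    (LinearMap.toContinuousLinearMap M.mulVecLin).hasFDerivAt.comp x hz'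
  have h3 := (h1.add_const (b m)).add ((h2.sub_const (M *ᵥ z x)).const_smul t)
  have hB' : HasFDerivAt G B (W m *ᵥ z x + b m + t • (M *ᵥ z x - M *ᵥ z x)) := by
    simpa using hB
  have h4 : HasFDerivAt (fun h => G h o) (ContinuousLinearMap.proj o ∘L B)
      (W m *ᵥ z x + b m + t • (M *ᵥ z x - M *ᵥ z x)) := hasFDerivAt_pi'.1 hB' o
  refine (h4.comp x h3).congr_fderiv ?_
  ext y
  simp [hM, hη, hBe, mul_comm]

/-- Outputs of a feed-forward network depend smoothly on the input and on all parameters. -/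
theorem contDiff_feedForward {V : Type*} [NormedAddCommGroup V] [NormedSpace ℝ V] {k : WithTop ℕ∞}
    (hs : ∀ j i, ContDiff ℝ k (s j i))
    {W : V → ∀ j, Matrix (Fin (d (j + 1))) (Fin (d j)) ℝ} {b : V → ∀ j, Fin (d (j + 1)) → ℝ}
    {x : V → Fin (d 0) → ℝ} (hW : ∀ j p q, ContDiff ℝ k fun v => W v j p q)
    (hb : ∀ j p, ContDiff ℝ k fun v => b v j p) (hx : ∀ p, ContDiff ℝ k fun v => x v p)
    (j : ℕ) (i : Fin (d j)) : ContDiff ℝ k fun v => feedForward s (W v) (b v) (x v) j i := by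
  induction j with
  | zero => exact hx i
  | succ j ih =>
    simp only [feedForward, affineLayer, Pi.add_apply, Matrix.mulVec, dotProduct]
    exact (ContDiff.sum fun q _ => (hW j i q).mul ((hs j q).comp (ih q))).add (hb j i)

end Network

/-! ### Generic rank of the weights -/

section Generic

variable {A : MLP.Architecture}

theorem Matrix.mulVec_injective_of_det_submatrix_ne_zero {p q : ℕ} (hqp : q ≤ p)
    {W : Matrix (Fin p) (Fin q) ℝ} (h : (W.submatrix (Fin.castLE hqp) id).det ≠ 0) :
    Function.Injective W.mulVec := by
  intro x y hxy
  have hu := Matrix.isUnit_iff_isUnit_det _ |>.2 (isUnit_iff_ne_zero.2 h)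
  refine Matrix.mulVec_injective_of_isUnit hu ?_
  funext i
  exact congrFun hxy (Fin.castLE hqp i)

theorem Matrix.mulVec_surjective_of_det_submatrix_ne_zero {p q : ℕ} (hpq : p ≤ q)
    {W : Matrix (Fin p) (Fin q) ℝ} (h : (W.submatrix id (Fin.castLE hpq)).det ≠ 0) :
    Function.Surjective W.mulVec := by
  intro y
  refine ⟨((1 : Matrix (Fin q) (Fin q) ℝ).submatrix id (Fin.castLE hpq) *
    (W.submatrix id (Fin.castLE hpq))⁻¹) *ᵥ y, ?_⟩
  have e : W * (1 : Matrix (Fin q) (Fin q) ℝ).submatrix id (Fin.castLE hpq) =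
      W.submatrix id (Fin.castLE hpq) := by
    ext i j
    simp [Matrix.mul_apply, Matrix.one_apply]
  rw [Matrix.mulVec_mulVec, ← Matrix.mul_assoc, e,
    Matrix.mul_nonsing_inv _ (isUnit_iff_ne_zero.2 h), Matrix.one_mulVec]

/-- A square submatrix of a weight matrix whose rows and columns are enumerated compatibly is
invertible for almost all parameters. -/
theorem ae_det_submatrix_weight_ne_zero (j : Fin (2 * A.depth)) {r : ℕ}
    (f : Fin r → Fin (A.width (j + 1))) (g : Fin r → Fin (A.width j))
    (hf : ∀ i, (f i : ℕ) = i) (hg : ∀ i, (g i : ℕ) = i) :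
    ∀ᵐ v : A.Params ∂volume, ((MLP.Architecture.weight v j).submatrix f g).det ≠ 0 := by
  -- Moving by `t • w` adds `t` times the identity to the submatrix `M`. Its determinant becomes the
  -- characteristic polynomial of `-M` at `t`, with finitely many roots.
  let w : A.Params := Sum.elim (fun a => if (a.2.1 : ℕ) = a.2.2 then 1 else 0) 0
  have hcont : Continuous fun v : A.Params => ((MLP.Architecture.weight v j).submatrix f g).det := by
    refine Continuous.matrix_det (continuous_matrix fun a b => ?_)
    exact continuous_apply (A := fun _ => ℝ) (Sum.inl ⟨j, (f a, g b)⟩ : A.WeightIndex ⊕ A.BiasIndex)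
  have hm : MeasurableSet {v : A.Params | ((MLP.Architecture.weight v j).submatrix f g).det ≠ 0} :=
    (isOpen_ne_fun hcont continuous_const).measurableSet
  refine ae_mem_of_ae_add_linearMap_mem (LinearMap.toSpanSingleton ℝ A.Params w) volume volume hm
    fun v => ?_
  set M := (MLP.Architecture.weight v j).submatrix f g with hM
  have hfin : {t : ℝ | (-M).charpoly.IsRoot t}.Finite :=
    Polynomial.finite_setOfPred_isRoot (Matrix.charpoly_monic _).ne_zero
  refine measure_mono_null ?_ (hfin.measure_zero volume)
  intro t ht
  have ht' : ((MLP.Architecture.weight (v + t • w) j).submatrix f g).det = 0 := by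
    by_contra hne
    exact ht hne
  have e : (MLP.Architecture.weight (v + t • w) j).submatrix f g =
      Matrix.scalar (Fin r) t - (-M) := by
    ext a b
    by_cases hab : a = b
    · subst hab
      simp [MLP.Architecture.weight, w, hM, hf, hg, add_comm]
    · have : (a : ℕ) ≠ b := fun h => hab (Fin.ext h)
      simp [MLP.Architecture.weight, w, hM, hf, hg, hab, this]
  change (-M).charpoly.eval t = 0
  rw [Matrix.eval_charpoly, ← e, ht']

theorem ae_weight_mulVec_injective :
    ∀ᵐ v : A.Params ∂volume, ∀ j : Fin (2 * A.depth), A.width j ≤ A.width (j + 1) →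
      Function.Injective (MLP.Architecture.weight v j).mulVec := by
  refine ae_all_iff.2 fun j => ?_
  by_cases h : A.width j ≤ A.width (j + 1)
  · filter_upwards [ae_det_submatrix_weight_ne_zero j (Fin.castLE h) id (fun _ => rfl)
      fun _ => rfl] with v hv _
    exact Matrix.mulVec_injective_of_det_submatrix_ne_zero h hv
  · exact Filter.Eventually.of_forall fun v h' => absurd h' h

theorem ae_weight_mulVec_surjective :
    ∀ᵐ v : A.Params ∂volume, ∀ j : Fin (2 * A.depth), A.width (j + 1) ≤ A.width j →
      Function.Surjective (MLP.Architecture.weight v j).mulVec := by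
  refine ae_all_iff.2 fun j => ?_
  by_cases h : A.width (j + 1) ≤ A.width j
  · filter_upwards [ae_det_submatrix_weight_ne_zero j id (Fin.castLE h) (fun _ => rfl)
      fun _ => rfl] with v hv _
    exact Matrix.mulVec_surjective_of_det_submatrix_ne_zero h hv
  · exact Filter.Eventually.of_forall fun v h' => absurd h' h

end Generic

/-! ### The Hessian as derivative of the gradient -/

section Hessian

variable {n : ℕ}

theorem gradient_apply_eq_fderiv_single (f : EuclideanSpace ℝ (Fin n) → ℝ)
    (y : EuclideanSpace ℝ (Fin n)) (j : Fin n) :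
    gradient f y j = fderiv ℝ f y (EuclideanSpace.single j 1) := by
  have h : inner ℝ (gradient f y) (EuclideanSpace.single j 1) =
      fderiv ℝ f y (EuclideanSpace.single j 1) := by
    simp [gradient]
  rw [← h, EuclideanSpace.inner_single_right]
  simp

/-- In the standard basis the two matrices are transposes of each other, so symmetry of second
derivatives is not needed. -/
theorem det_hessian_eq {f : EuclideanSpace ℝ (Fin n) → ℝ} {p : EuclideanSpace ℝ (Fin n)}
    (hf : DifferentiableAt ℝ (gradient f) p) :
    (MLP.hessian f p).det = (fderiv ℝ (gradient f) p).det := by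
  have e : LinearMap.toMatrix (EuclideanSpace.basisFun (Fin n) ℝ).toBasis
      (EuclideanSpace.basisFun (Fin n) ℝ).toBasis
      (fderiv ℝ (gradient f) p : EuclideanSpace ℝ (Fin n) →ₗ[ℝ] EuclideanSpace ℝ (Fin n)) =
      (MLP.hessian f p)ᵀ := by
    ext j i
    have h : (fun y => fderiv ℝ f y (EuclideanSpace.single j 1)) =
        fun y => EuclideanSpace.proj (𝕜 := ℝ) j (gradient f y) := by
      funext y
      exact (gradient_apply_eq_fderiv_single f y j).symm
    have h' := ((EuclideanSpace.proj (𝕜 := ℝ) j).hasFDerivAt.comp p hf.hasFDerivAt).fderiv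
    simp only [Function.comp_def] at h'
    simp only [MLP.hessian, Matrix.transpose_apply, Matrix.of_apply, h, h']
    simp [LinearMap.toMatrix_apply]
  rw [← Matrix.det_transpose, ← e, LinearMap.det_toMatrix]

end Hessian

/-! ### The perceptron as a feed-forward network -/

section Realize

variable {A : MLP.Architecture}

/-- The weight matrices, extended by zero to a sequence. -/
def weightSeq (v : A.Params) (j : ℕ) : Matrix (Fin (A.width (j + 1))) (Fin (A.width j)) ℝ :=
  if h : j < 2 * A.depth then MLP.Architecture.weight v ⟨j, h⟩ else 0

/-- The bias vectors, extended by zero to a sequence. -/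
def biasSeq (v : A.Params) (j : ℕ) : Fin (A.width (j + 1)) → ℝ :=
  if h : j < 2 * A.depth then MLP.Architecture.bias v ⟨j, h⟩ else 0

/-- The activation functions in the joint enumeration of the layers: the identity on main layers. -/
def activationSeq (σ : A.Activations) (j : ℕ) (i : Fin (A.width j)) : ℝ → ℝ :=
  if h : j % 2 = 1 ∧ j / 2 < A.depth then
    σ ⟨j / 2, h.2⟩ (Fin.cast (congrArg A.width (by have := h.1; simp only; omega)) i)
  else id

theorem activationSeq_even (σ : A.Activations) (l : ℕ) (i : Fin (A.width (2 * l))) :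
    activationSeq σ (2 * l) i = id :=
  dif_neg (by omega)

theorem activationSeq_odd (σ : A.Activations) (l : ℕ) (hl : l < A.depth)
    (i : Fin (A.width (2 * l + 1))) : activationSeq σ (2 * l + 1) i = σ ⟨l, hl⟩ i := by
  -- `(2 * l + 1) / 2` is generalized to `l'`, so that substitution removes the cast.
  have key : ∀ (l' : ℕ) (h' : l' < A.depth) (e : l' = l),
      σ ⟨l', h'⟩ (Fin.cast (by subst e; rfl) i) = σ ⟨l, hl⟩ i := by
    rintro l' h' rfl
    rfl
  have h : (2 * l + 1) % 2 = 1 ∧ (2 * l + 1) / 2 < A.depth := by omega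
  rw [activationSeq, dif_pos h]
  exact key _ _ (by omega)

theorem activationSeq_contDiff {k : ℕ∞} {σ : A.Activations}
    (hσ : MLP.Architecture.Admissible k σ) (j : ℕ) (i : Fin (A.width j)) :
    ContDiff ℝ k (activationSeq σ j i) := by
  unfold activationSeq
  split_ifs with h
  · exact (hσ _ _).1
  · exact contDiff_id

theorem activationSeq_deriv_ne_zero {k : ℕ∞} {σ : A.Activations}
    (hσ : MLP.Architecture.Admissible k σ) (j : ℕ) (i : Fin (A.width j)) (t : ℝ) :
    deriv (activationSeq σ j i) t ≠ 0 := by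
  unfold activationSeq
  split_ifs with h
  · rcases (hσ ⟨j / 2, h.2⟩ (Fin.cast (congrArg A.width (by have := h.1; simp only; omega)) i)).2
      with h | h
    · exact (h t).ne'
    · exact (h t).ne
  · simp

theorem mainLayer_eq_feedForward (σ : A.Activations) (v : A.Params) (x : Fin (A.width 0) → ℝ)
    (l : ℕ) (hl : l ≤ A.depth) :
    MLP.Architecture.mainLayer σ v x l hl =
      feedForward (activationSeq σ) (weightSeq v) (biasSeq v) x (2 * l) := by
  induction l with
  | zero => rfl
  | succ l ih =>
    have h₁ : 2 * l < 2 * A.depth := by omega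
    have h₂ : 2 * l + 1 < 2 * A.depth := by omega
    change _ = affineLayer (activationSeq σ (2 * l + 1)) (weightSeq v (2 * l + 1))
      (biasSeq v (2 * l + 1)) (affineLayer (activationSeq σ (2 * l)) (weightSeq v (2 * l))
        (biasSeq v (2 * l)) (feedForward (activationSeq σ) (weightSeq v) (biasSeq v) x (2 * l)))
    simp only [affineLayer, activationSeq_even, activationSeq_odd σ l hl, id, weightSeq, biasSeq,
      dif_pos h₁, dif_pos h₂, ← ih (Nat.le_of_succ_le hl)]
    rfl

theorem realize_eq_feedForward (σ : A.Activations) (v : A.Params)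
    (x : EuclideanSpace ℝ (Fin (A.width 0))) :
    MLP.Architecture.realize σ v x =
      feedForward (activationSeq σ) (weightSeq v) (biasSeq v) (fun i => x i) (2 * A.depth)
        ⟨0, by rw [A.width_output]; exact Nat.one_pos⟩ := by
  rw [MLP.Architecture.realize, mainLayer_eq_feedForward]

theorem contDiff_realize {k : ℕ∞} {σ : A.Activations}
    (hσ : MLP.Architecture.Admissible k σ) :
    ContDiff ℝ k fun p : EuclideanSpace ℝ (Fin (A.width 0)) × A.Params =>
      MLP.Architecture.realize σ p.2 p.1 := by
  simp only [realize_eq_feedForward]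
  refine contDiff_feedForward (activationSeq_contDiff hσ) (fun j p q => ?_) (fun j p => ?_)
    (fun p => ?_) _ _
  · unfold weightSeq
    split_ifs with h
    · exact (contDiff_apply ℝ ℝ (Sum.inl ⟨⟨j, h⟩, (p, q)⟩ : A.WeightIndex ⊕ A.BiasIndex)).comp
        contDiff_snd
    · exact contDiff_const
  · unfold biasSeq
    split_ifs with h
    · exact (contDiff_apply ℝ ℝ (Sum.inr ⟨⟨j, h⟩, p⟩ : A.WeightIndex ⊕ A.BiasIndex)).comp
        contDiff_snd
    · exact contDiff_const
  · exact (EuclideanSpace.proj (𝕜 := ℝ) p).contDiff.comp contDiff_fst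

/-- The gradient of the network function as a function of input and parameters. -/
noncomputable def gradientMap (σ : A.Activations) (p : EuclideanSpace ℝ (Fin (A.width 0)) × A.Params) :
    EuclideanSpace ℝ (Fin (A.width 0)) :=
  gradient (MLP.Architecture.realize σ p.2) p.1

/-- One derivative is lost, hence `2 ≤ k`: transversality needs a `C¹` map. -/
theorem contDiff_gradientMap {k : ℕ∞} (hk : 2 ≤ k) {σ : A.Activations}
    (hσ : MLP.Architecture.Admissible k σ) : ContDiff ℝ 1 (gradientMap σ) := by
  have h2 : ContDiff ℝ 2 fun p : EuclideanSpace ℝ (Fin (A.width 0)) × A.Params =>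
      MLP.Architecture.realize σ p.2 p.1 := (contDiff_realize hσ).of_le (WithTop.coe_le_coe.2 hk)
  have h : ContDiff ℝ 1 fun p : EuclideanSpace ℝ (Fin (A.width 0)) × A.Params =>
      fderiv ℝ (MLP.Architecture.realize σ p.2) p.1 := by
    refine ContDiff.fderiv (m := 2) (f := fun p : EuclideanSpace ℝ (Fin (A.width 0)) × A.Params =>
      MLP.Architecture.realize σ p.2) ?_ contDiff_fst (by norm_num)
    exact h2.comp (contDiff_snd.prodMk (contDiff_snd.comp contDiff_fst))
  exact (InnerProductSpace.toDual ℝ (EuclideanSpace ℝ (Fin (A.width 0)))).symm.contDiff.comp h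

/-- Along a suitable parameter line through `v`, the gradient at `x` is affine in `t` with the
prescribed slope `η`. -/
theorem gradientMap_surjective_fderiv_params {k : ℕ∞} (hk : 2 ≤ k) {σ : A.Activations}
    (hσ : MLP.Architecture.Admissible k σ) (v : A.Params) {m : ℕ} (hm : m < 2 * A.depth)
    (hinj : ∀ j : Fin (2 * A.depth), (j : ℕ) < m →
      Function.Injective (MLP.Architecture.weight v j).mulVec)
    (hsurj : ∀ j : Fin (2 * A.depth), m < j →
      Function.Surjective (MLP.Architecture.weight v j).mulVec)
    (x : EuclideanSpace ℝ (Fin (A.width 0))) :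
    Function.Surjective (fderiv ℝ (gradientMap σ) (x, v) ∘L
      .inr ℝ (EuclideanSpace ℝ (Fin (A.width 0))) A.Params) := by
  intro η
  set φ := EuclideanSpace.equiv (Fin (A.width 0)) ℝ
  have hk0 : (k : WithTop ℕ∞) ≠ 0 := by
    exact_mod_cast (lt_of_lt_of_le (by norm_num) hk).ne'
  obtain ⟨δ, ε, D₀, hδ, hε, hD⟩ := exists_direction_deriv_eq (s := activationSeq σ)
    (fun j i => (activationSeq_contDiff hσ j i).differentiable hk0)
    (activationSeq_deriv_ne_zero hσ) (weightSeq v) (biasSeq v) hm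
    (fun i hi => by
      rw [weightSeq, dif_pos (hi.trans hm)]
      exact hinj ⟨i, hi.trans hm⟩ hi)
    (fun i hi hi' => by
      rw [weightSeq, dif_pos hi']
      exact hsurj ⟨i, hi'⟩ hi)
    (φ x) ⟨0, by rw [A.width_output]; exact Nat.one_pos⟩
    (InnerProductSpace.toDual ℝ _ η ∘L (φ.symm : _ →L[ℝ] _))
  let w : A.Params := Sum.elim (fun a => δ a.1 a.2.1 a.2.2) (fun a => ε a.1 a.2)
  have hW : ∀ t : ℝ, weightSeq (v + t • w) = weightSeq v + t • δ := fun t => by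
    funext j
    by_cases h : j < 2 * A.depth
    · simp only [weightSeq, dif_pos h, Pi.add_apply, Pi.smul_apply]
      rfl
    · simp [weightSeq, dif_neg h, hδ j (by omega)]
  have hb : ∀ t : ℝ, biasSeq (v + t • w) = biasSeq v + t • ε := fun t => by
    funext j
    by_cases h : j < 2 * A.depth
    · simp only [biasSeq, dif_pos h, Pi.add_apply, Pi.smul_apply]
      rfl
    · simp [biasSeq, dif_neg h, hε j (by omega)]
  have hgrad : ∀ t : ℝ, gradientMap σ (x, v + t • w) =
      (InnerProductSpace.toDual ℝ _).symm (D₀ ∘L (φ : _ →L[ℝ] _)) + t • η := fun t => by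
    have h := HasFDerivAt.comp x (hD t) φ.hasFDerivAt
    have hr : MLP.Architecture.realize σ (v + t • w) = (fun y => feedForward (activationSeq σ)
        (weightSeq v + t • δ) (biasSeq v + t • ε) y (2 * A.depth)
          ⟨0, by rw [A.width_output]; exact Nat.one_pos⟩) ∘ φ := by
      funext y
      rw [realize_eq_feedForward, hW, hb]
      rfl
    rw [gradientMap, gradient]
    simp only
    rw [hr, h.fderiv]
    apply (InnerProductSpace.toDual ℝ _).injective
    rw [LinearIsometryEquiv.apply_symm_apply, map_add, LinearIsometryEquiv.apply_symm_apply]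
    ext y
    simp
  refine ⟨w, ?_⟩
  have h1 : HasDerivAt (fun t : ℝ => gradientMap σ (x, v + t • w))
      (fderiv ℝ (gradientMap σ) (x, v) (0, w)) 0 := by
    have hF : HasFDerivAt (gradientMap σ) (fderiv ℝ (gradientMap σ) (x, v))
        (x, v + (0 : ℝ) • w) := by
      simpa using ((contDiff_gradientMap hk hσ).differentiable one_ne_zero (x, v)).hasFDerivAt
    have hline : HasDerivAt (fun t : ℝ => v + t • w) w 0 := by
      simpa using ((hasDerivAt_id (0 : ℝ)).smul_const w).const_add v
    exact HasFDerivAt.comp_hasDerivAt (f := fun t : ℝ => (x, v + t • w)) (0 : ℝ) hF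
      ((hasDerivAt_const (0 : ℝ) x).prodMk hline)
  have h2 : HasDerivAt (fun t : ℝ => gradientMap σ (x, v + t • w)) η 0 := by
    simp only [hgrad]
    simpa using ((hasDerivAt_id (0 : ℝ)).smul_const η).const_add
      ((InnerProductSpace.toDual ℝ _).symm (D₀ ∘L (φ : _ →L[ℝ] _)))
  exact h1.unique h2

theorem ae_isMorse_realize (hA : A.IsAugmented) {k : ℕ∞} (hk : 2 ≤ k) {σ : A.Activations}
    (hσ : MLP.Architecture.Admissible k σ) :
    ∀ᵐ v : A.Params ∂volume, ∀ x, gradient (MLP.Architecture.realize σ v) x = 0 →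
      (MLP.hessian (MLP.Architecture.realize σ v) x).det ≠ 0 := by
  obtain ⟨m, hm, -, -, hwide, hup, hdown⟩ := hA
  -- The bound `n + 1` on the maximal width excludes the input layer, so a weight matrix enters the
  -- widest layer. It has index `m`, and it is the one perturbed.
  obtain ⟨m, rfl⟩ : ∃ m', m = m' + 1 :=
    Nat.exists_eq_succ_of_ne_zero (by rintro rfl; omega)
  have hF := contDiff_gradientMap hk hσ
  have hsub : ∀ᵐ v : A.Params ∂volume, ∀ x, gradientMap σ (x, v) = 0 →
      Function.Surjective (fderiv ℝ (gradientMap σ) (x, v) ∘L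
        .inr ℝ (EuclideanSpace ℝ (Fin (A.width 0))) A.Params) := by
    filter_upwards [ae_weight_mulVec_injective, ae_weight_mulVec_surjective] with v h1 h2 x _
    exact gradientMap_surjective_fderiv_params hk hσ v hm
      (fun j hj => h1 j (hup j (by omega))) (fun j hj => h2 j (hdown j hj j.2)) x
  filter_upwards [ae_regular_zeros volume hF hsub] with v hv x hx
  have hd : HasFDerivAt (gradient (MLP.Architecture.realize σ v))
      (fderiv ℝ (gradientMap σ) (x, v) ∘L
        .inl ℝ (EuclideanSpace ℝ (Fin (A.width 0))) A.Params) x :=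
    HasFDerivAt.comp (f := fun y => (y, v)) x
      (hF.differentiable one_ne_zero (x, v)).hasFDerivAt (hasFDerivAt_prodMk_left x v)
  rw [det_hessian_eq hd.differentiableAt, hd.fderiv]
  exact hv x hx

end Realize

theorem mainTheorem2 (A : MLP.Architecture) (hA : A.IsAugmented)
    (X : Set (EuclideanSpace ℝ (Fin (A.width 0)))) (hX : IsOpen X)
    (k : ℕ∞) (hk : 2 ≤ k) (σ : A.Activations) (hσ : MLP.Architecture.Admissible k σ) :
    (∀ᵐ v : A.Params ∂MeasureTheory.volume, MLP.Architecture.FullRank v →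
      (MLP.Architecture.realize σ v ∈ MLP.classC1 k X ∨
        MLP.Architecture.realize σ v ∈ MLP.classC2 k X) ∧
      MLP.IsMorseOn X (MLP.Architecture.realize σ v)) ∧
    (∀ᵐ v : A.Params ∂MeasureTheory.volume,
      (MLP.Architecture.realize σ v ∈ MLP.classC1 k X ∨
        MLP.Architecture.realize σ v ∈ MLP.classC2 k X) ∧
      MLP.IsMorseOn X (MLP.Architecture.realize σ v)) := by
  have main : ∀ᵐ v : A.Params ∂MeasureTheory.volume,
      (MLP.Architecture.realize σ v ∈ MLP.classC1 k X ∨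
        MLP.Architecture.realize σ v ∈ MLP.classC2 k X) ∧
      MLP.IsMorseOn X (MLP.Architecture.realize σ v) := by
    filter_upwards [ae_isMorse_realize hA hk hσ] with v hv
    have hc : ContDiff ℝ k (MLP.Architecture.realize σ v) :=
      (contDiff_realize hσ).comp (contDiff_prodMk_left v)
    refine ⟨?_, (hc.of_le (WithTop.coe_le_coe.2 hk)).contDiffOn, fun p _ => hv p⟩
    by_cases h : ∃ p ∈ X, gradient (MLP.Architecture.realize σ v) p = 0
    · exact Or.inr ⟨hc.contDiffOn, h, fun q _ => hv q⟩
    · exact Or.inl ⟨hc.contDiffOn, fun p hp h0 => h ⟨p, hp, h0⟩⟩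
  exact ⟨main.mono fun v hv _ => hv, main⟩
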